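/- **Theorem (Spohn, entropy production rate).** Let $(T_t)_{t\ge 0}$ be a quantum dynamical semigroup on the $n\times n$ complex matrices, i.e. a continuous one-parameter semigroup of completely positive trace-preserving linear maps with $T_0=\mathrm{id}$, and let $\mathcal L(X)=\lim_{h\downarrow 0}(T_hX-X)/h$ be its generator. Let $\tau$ be a density matrix with $\mathcal L(\tau)=0$, let $\rho(0)$ be a density matrix with $D(\rho(0)\|\tau)<\infty$ (i.e. $\operatorname{supp}\rho(0)\subseteq\operatorname{supp}\tau$; this is automatic if $\tau$ has full rank), and put $\rho(t)=T_t(\rho(0))$ for $t\ge 0$. Here $D(\rho\|\tau)=\mathrm{Tr}[\rho(\log\rho-\log\tau)]$ is the relative entropy, and traces of the form $\mathrm{Tr}[A\log B]$ are taken in the extended reals with the conventions $\log 0=-\infty$ and $0\cdot(-\infty)=0$: for $A$ Hermitian and $B$ positive semidefinite, $\mathrm{Tr}[A\log B]$ is the trace of $A$ against $\log B$ on the support of $B$, plus $\mathrm{Tr}[A(\mathbb 1-\Pi_B)]\cdot(-\infty)$, where $\Pi_B$ is the orthogonal projector onto the support of $B$. Then for every $t\ge 0$ the entropy production rate $$\sigma(\rho(t)):=-\frac{\mathrm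 d D(\rho(t)\|\tau)}{\mathrm d t}$$ exists as a limit of difference quotients in $[-\infty,\infty]$ (two-sided for $t>0$, from the right for $t=0$), and $$\sigma(\rho(t))=\mathrm{Tr}\big[\mathcal L(\rho(t))(\log\tau-\log\rho(t))\big]+\mathrm{Tr}\big[\mathcal L(\rho(t))\,\Pi_{\rho(t)}\big]\ \ge\ 0 .$$ Moreover, the second term $\mathrm{Tr}[\mathcal L(\rho(t))\Pi_{\rho(t)}]$ vanishes at all times $t$ at which the rate $\sigma(\rho(t))$ is finite. -/

import Mathlib

open Filter Topology
open scoped ComplexOrder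

noncomputable section

namespace QuantumSemigroup

variable {n : Type*} [Fintype n] [DecidableEq n]

/-- A density matrix (quantum state): positive semidefinite with unit trace. -/
def IsState (ρ : Matrix n n ℂ) : Prop :=
  ρ.PosSemidef ∧ ρ.trace = 1

/-- Complete positivity: every ampliation `id_k ⊗ Φ`, applied blockwise to a `k × k` block matrix
with entries in `Matrix n n ℂ`, preserves positive semidefiniteness. -/
def IsCompletelyPositive (Φ : Matrix n n ℂ →ₗ[ℂ] Matrix n n ℂ) : Prop :=
  ∀ (k : ℕ) (A : Matrix (Fin k) (Fin k) (Matrix n n ℂ)),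
    (Matrix.comp (Fin k) (Fin k) n n ℂ A).PosSemidef →
      (Matrix.comp (Fin k) (Fin k) n n ℂ (A.map Φ)).PosSemidef

/-- Completely positive and trace preserving. -/
def IsCPTP (Φ : Matrix n n ℂ →ₗ[ℂ] Matrix n n ℂ) : Prop :=
  IsCompletelyPositive Φ ∧ ∀ X, (Φ X).trace = X.trace

/-- A quantum dynamical semigroup: a one-parameter, continuous semigroup of CPTP maps. Only the
values at times `t ≥ 0` matter. -/
structure IsDynamicalSemigroup (T : ℝ → (Matrix n n ℂ →ₗ[ℂ] Matrix n n ℂ)) : Prop where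
  cptp : ∀ t, 0 ≤ t → IsCPTP (T t)
  zero : T 0 = LinearMap.id
  add : ∀ s t, 0 ≤ s → 0 ≤ t → T (s + t) = T s ∘ₗ T t
  continuous_zero : ∀ X, Tendsto (fun t => T t X) (𝓝[>] 0) (𝓝 X)

/-- `L` is the generator of `T`: `L X = lim_{h ↓ 0} (T h X - X) / h`. -/
def IsGenerator (T : ℝ → (Matrix n n ℂ →ₗ[ℂ] Matrix n n ℂ))
    (L : Matrix n n ℂ →ₗ[ℂ] Matrix n n ℂ) : Prop :=
  ∀ X, Tendsto (fun h : ℝ => h⁻¹ • (T h X - X)) (𝓝[>] 0) (𝓝 (L X))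

/-- The orthogonal projector onto the support of a Hermitian matrix `B`, i.e. onto the span of the
eigenvectors with nonzero eigenvalue. -/
def supportProj (B : Matrix n n ℂ) : Matrix n n ℂ :=
  cfc (fun x : ℝ => if x = 0 then (0 : ℝ) else 1) B

/-- `Tr[A log B]` in the extended reals, for `A` Hermitian and `B` positive semidefinite, with the
conventions `log 0 = -∞` and `0 · (-∞) = 0`. As `Real.log 0 = 0`, the first summand is the
contribution of the support of `B`. The second is the weight of `A` on the kernel of `B`, times
`-∞`; in `EReal` one has `0 * ⊥ = 0`, `a * ⊥ = ⊥` for `a > 0` and `a * ⊥ = ⊤` for `a < 0`. -/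
def traceLog (A B : Matrix n n ℂ) : EReal :=
  (((A * cfc Real.log B).trace.re : ℝ) : EReal)
    + (((A * (1 - supportProj B)).trace.re : ℝ) : EReal) * ⊥

/-- `Tr[A (log X - log Y)]` in the extended reals. -/
def traceLogSub (A X Y : Matrix n n ℂ) : EReal :=
  traceLog A X - traceLog A Y

/-- The relative entropy `D(ρ‖τ) = Tr[ρ (log ρ - log τ)]` of states; it equals `⊤` exactly when the
support of `ρ` is not contained in that of `τ`. -/
def relEntropy (ρ τ : Matrix n n ℂ) : EReal :=
  traceLogSub ρ ρ τ

/-- `σ` is the entropy production rate `-dD(ρ(t)‖τ)/dt` at time `t` of the trajectory `ρ`, which is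
defined on `[0, ∞)`. The derivative is the limit of difference quotients in the extended reals,
two-sided at `t > 0` and one-sided at `t = 0`. -/
def HasEntropyProductionRate (ρ : ℝ → Matrix n n ℂ) (τ : Matrix n n ℂ) (t : ℝ) (σ : EReal) : Prop :=
  Tendsto (fun h : ℝ => -((relEntropy (ρ (t + h)) τ - relEntropy (ρ t) τ) / (h : EReal)))
    (𝓝[{h : ℝ | h ≠ 0 ∧ 0 ≤ t + h}] 0) (𝓝 σ)

end QuantumSemigroup

end

open Filter Topology
open scoped ComplexOrder

noncomputable section

namespace QuantumSemigroup

open Matrix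

variable {n : Type*} [Fintype n] [DecidableEq n]

/-! Two facts carry the theorem: channels do not increase relative entropy, and `Tr (A log A)` has a
controllable first-order expansion even at singular states.

Monotonicity. `kosaki` at parameter `t` is the minimum over `x` of `Tr A(1-x)ᴴ(1-x) + t⁻¹ Tr B x
xᴴ`. The Schwarz inequality for the unital dual of a channel shows that pulling an optimal `x` back
through the dual does not raise the value, so `kosaki` grows under channels
(`IsCPTP.kosaki_le_kosaki`). Letting `t ↓ 0` shows that inclusion of supports is preserved, and
integrating against `dt/t` gives `IsCPTP.data_processing`. Since `τ` is fixed, the relative entropy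
along the trajectory stays finite and nonincreasing, so every rate is nonnegative.

Expansion. The semigroup is an exponential, so trajectories have second-order Taylor expansions.
With `B = ρ t` and `M = L B`, the remainder of `Tr (A log A)` after its linear terms is governed by
the leakage `Tr ρ(t+h)(1-Π_B)`, the weight that enters the kernel of `B`. If `Tr M(1-Π_B) = 0`, the
leakage is `O(h²)`, the remainder is `o(h)` and the rate is finite. If it is positive, the remainder
divided by `h` tends to `-∞` and the rate is `⊤`. The leakage is nonnegative and zero at `h = 0`;
for `t > 0` this is an interior minimum, so the infinite case occurs only at `t = 0`. Finally `Tr M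
= 0` gives `Tr M Π_B = -Tr M(1-Π_B)`, which vanishes in the finite case. -/

/-! ### Traces as double sums over two eigenbases -/

/-- The functional calculus of a Hermitian matrix, written in its eigenbasis. -/
theorem cfc_eq_conj_diagonal {A : Matrix n n ℂ} (hA : A.IsHermitian) (f : ℝ → ℝ) :
    cfc f A = (hA.eigenvectorUnitary : Matrix n n ℂ)
      * diagonal (fun i => ((f (hA.eigenvalues i) : ℝ) : ℂ))
      * (hA.eigenvectorUnitary : Matrix n n ℂ)ᴴ := by
  rw [hA.cfc_eq f, IsHermitian.cfc, Unitary.conjStarAlgAut_apply]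
  rfl

/-- The matrix of inner products between the eigenvectors of `B` and those of `A`. -/
def overlapMatrix {A B : Matrix n n ℂ} (hA : A.IsHermitian) (hB : B.IsHermitian) :
    Matrix n n ℂ :=
  (hB.eigenvectorUnitary : Matrix n n ℂ)ᴴ * (hA.eigenvectorUnitary : Matrix n n ℂ)

/-- The transition probabilities between the eigenvectors of `A` and those of `B`. -/
def overlap {A B : Matrix n n ℂ} (hA : A.IsHermitian) (hB : B.IsHermitian) (i j : n) : ℝ :=
  Complex.normSq (overlapMatrix hA hB j i)

theorem overlap_nonneg {A B : Matrix n n ℂ} (hA : A.IsHermitian) (hB : B.IsHermitian) (i j : n) :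
    0 ≤ overlap hA hB i j :=
  Complex.normSq_nonneg _

theorem trace_diagonal_mul_conjTranspose (a b : n → ℝ) (X : Matrix n n ℂ) :
    (diagonal (fun i => (a i : ℂ)) * (Xᴴ * (diagonal (fun j => (b j : ℂ)) * X))).trace
      = ((∑ i, ∑ j, Complex.normSq (X j i) * (a i * b j) : ℝ) : ℂ) := by
  simp only [Matrix.trace, Matrix.diag_apply, Matrix.diagonal_mul, Matrix.mul_apply (M := Xᴴ),
    Matrix.conjTranspose_apply]
  push_cast
  refine Finset.sum_congr rfl fun i _ => ?_
  rw [Finset.mul_sum]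
  refine Finset.sum_congr rfl fun j _ => ?_
  rw [← Complex.mul_conj]
  simp only [RCLike.star_def]
  ring

theorem conjTranspose_mul_eigenvectorUnitary {A : Matrix n n ℂ} (hA : A.IsHermitian) :
    (hA.eigenvectorUnitary : Matrix n n ℂ)ᴴ * (hA.eigenvectorUnitary : Matrix n n ℂ) = 1 :=
  Unitary.coe_star_mul_self hA.eigenvectorUnitary

/-- Traces of products of functions of two Hermitian matrices as double sums over eigenvalues. -/
theorem trace_cfc_mul_mul_mul {A B : Matrix n n ℂ} (hA : A.IsHermitian) (hB : B.IsHermitian)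
    (f g : ℝ → ℝ) (y : Matrix n n ℂ) :
    (cfc f A * (yᴴ * (cfc g B * y))).trace =
      ((∑ i, ∑ j, Complex.normSq (((hB.eigenvectorUnitary : Matrix n n ℂ)ᴴ * y
        * (hA.eigenvectorUnitary : Matrix n n ℂ)) j i)
          * (f (hA.eigenvalues i) * g (hB.eigenvalues j)) : ℝ) : ℂ) := by
  rw [← trace_diagonal_mul_conjTranspose, cfc_eq_conj_diagonal hA, cfc_eq_conj_diagonal hB]
  simp only [conjTranspose_mul, conjTranspose_conjTranspose]
  rw [mul_assoc, mul_assoc, Matrix.trace_mul_comm]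
  simp only [mul_assoc]

theorem trace_cfc_mul_cfc {A B : Matrix n n ℂ} (hA : A.IsHermitian) (hB : B.IsHermitian)
    (f g : ℝ → ℝ) :
    (cfc f A * cfc g B).trace =
      ((∑ i, ∑ j, overlap hA hB i j * (f (hA.eigenvalues i) * g (hB.eigenvalues j)) : ℝ) : ℂ) := by
  have h := trace_cfc_mul_mul_mul hA hB f g 1
  simpa [overlap, overlapMatrix] using h

theorem cfc_id_real {A : Matrix n n ℂ} (hA : A.IsHermitian) : cfc (fun x : ℝ => x) A = A :=
  cfc_id' ℝ A hA

theorem cfc_one_real {A : Matrix n n ℂ} (hA : A.IsHermitian) :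
    cfc (fun _ : ℝ => (1 : ℝ)) A = 1 :=
  cfc_const_one ℝ A hA

/-! ### The Kosaki functional and its variational formula -/

/-- The Kosaki functional of a pair of positive matrices at parameter `t`. -/
def kosaki {A B : Matrix n n ℂ} (hA : A.IsHermitian) (hB : B.IsHermitian) (t : ℝ) : ℝ :=
  ∑ i, ∑ j, overlap hA hB i j *
    (hA.eigenvalues i * hB.eigenvalues j / (t * hA.eigenvalues i + hB.eigenvalues j))

/-- The right side is quadratic in `x` with minimiser `t*a*c/(t*a+b)`; completing the square leaves
a nonnegative term. If `t*a+b = 0`, division by zero makes the left side `0`. -/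
theorem sq_mul_div_le {a b t : ℝ} (ha : 0 ≤ a) (hb : 0 ≤ b) (ht : 0 < t) (c x : ℝ) :
    c ^ 2 * (a * b / (t * a + b)) ≤ a * (c - x) ^ 2 + t⁻¹ * (b * x ^ 2) := by
  rcases (add_nonneg (mul_nonneg ht.le ha) hb).eq_or_lt with h | h
  · rw [← h, div_zero, mul_zero]
    positivity
  · obtain ⟨s, hs⟩ : ∃ s, s = t * a + b := ⟨_, rfl⟩
    obtain rfl : b = s - t * a := by linarith
    rw [← hs] at h ⊢
    have : a * (c - x) ^ 2 + t⁻¹ * ((s - t * a) * x ^ 2) - c ^ 2 * (a * (s - t * a) / s)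
        = (s * x - t * a * c) ^ 2 / (t * s) := by
      field_simp
      ring
    have h2 : 0 ≤ (s * x - t * a * c) ^ 2 / (t * s) := by positivity
    linarith

theorem normSq_mul_div_le {a b t : ℝ} (ha : 0 ≤ a) (hb : 0 ≤ b) (ht : 0 < t) (c x : ℂ) :
    Complex.normSq c * (a * b / (t * a + b))
      ≤ Complex.normSq (c - x) * a + t⁻¹ * (Complex.normSq x * b) := by
  have h1 := sq_mul_div_le ha hb ht c.re x.re
  have h2 := sq_mul_div_le ha hb ht c.im x.im
  simp only [Complex.normSq_apply, Complex.sub_re, Complex.sub_im]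
  nlinarith

theorem normSq_mul_div_eq {a b t : ℝ} (ha : 0 ≤ a) (hb : 0 ≤ b) (ht : 0 < t) (c : ℂ) :
    Complex.normSq c * (a * b / (t * a + b))
      = Complex.normSq (c - ((t * a / (t * a + b) : ℝ) : ℂ) * c) * a
        + t⁻¹ * (Complex.normSq (((t * a / (t * a + b) : ℝ) : ℂ) * c) * b) := by
  rcases (add_nonneg (mul_nonneg ht.le ha) hb).eq_or_lt with h | h
  · have ha0 : a = 0 := by nlinarith
    have hb0 : b = 0 := by nlinarith
    simp [ha0, hb0]
  · obtain ⟨s, hs⟩ : ∃ s, s = t * a + b := ⟨_, rfl⟩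
    obtain rfl : b = s - t * a := by linarith
    rw [← hs] at h ⊢
    have h3 : c - ((t * a / s : ℝ) : ℂ) * c = (((s - t * a) / s : ℝ) : ℂ) * c := by
      have : ((s - t * a) / s : ℝ) = 1 - t * a / s := by field_simp
      rw [this]
      push_cast
      ring
    rw [h3, Complex.normSq_mul, Complex.normSq_mul, Complex.normSq_ofReal, Complex.normSq_ofReal]
    field_simp
    ring

theorem trace_mul_conjTranspose_mul_self {A B : Matrix n n ℂ} (hA : A.IsHermitian)
    (hB : B.IsHermitian) (y : Matrix n n ℂ) :
    (A * (yᴴ * y)).trace.re = ∑ i, ∑ j, Complex.normSq (((hB.eigenvectorUnitary : Matrix n n ℂ)ᴴ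
      * y * (hA.eigenvectorUnitary : Matrix n n ℂ)) j i) * hA.eigenvalues i := by
  have h := trace_cfc_mul_mul_mul hA hB (fun x => x) (fun _ => 1) y
  rw [cfc_id_real hA, cfc_one_real hB, one_mul] at h
  rw [h, Complex.ofReal_re]
  simp

theorem trace_mul_self_mul_conjTranspose {A B : Matrix n n ℂ} (hA : A.IsHermitian)
    (hB : B.IsHermitian) (x : Matrix n n ℂ) :
    (B * (x * xᴴ)).trace.re = ∑ i, ∑ j, Complex.normSq (((hB.eigenvectorUnitary : Matrix n n ℂ)ᴴ
      * x * (hA.eigenvectorUnitary : Matrix n n ℂ)) j i) * hB.eigenvalues j := by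
  have h := trace_cfc_mul_mul_mul hA hB (fun _ => 1) (fun x => x) x
  rw [cfc_id_real hB, cfc_one_real hA, one_mul, Matrix.trace_mul_comm, mul_assoc] at h
  rw [h, Complex.ofReal_re]
  simp

/-- In the mixed eigenbases `Vᴴ x U` both traces become weighted sums of squared entries, so the
minimisation over `x` decouples into scalar problems. The entries of `1` are those of
`overlapMatrix`. -/
theorem kosaki_le {A B : Matrix n n ℂ} (hA : A.PosSemidef) (hB : B.PosSemidef) {t : ℝ}
    (ht : 0 < t) (x : Matrix n n ℂ) :
    kosaki hA.1 hB.1 t ≤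
      (A * ((1 - x)ᴴ * (1 - x))).trace.re + t⁻¹ * (B * (x * xᴴ)).trace.re := by
  rw [trace_mul_conjTranspose_mul_self hA.1 hB.1, trace_mul_self_mul_conjTranspose hA.1 hB.1,
    kosaki]
  simp only [Finset.mul_sum, ← Finset.sum_add_distrib]
  refine Finset.sum_le_sum fun i _ => Finset.sum_le_sum fun j _ => ?_
  have := normSq_mul_div_le (hA.eigenvalues_nonneg i) (hB.eigenvalues_nonneg j) ht
    (overlapMatrix hA.1 hB.1 j i) (((hB.1.eigenvectorUnitary : Matrix n n ℂ)ᴴ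
      * x * (hA.1.eigenvectorUnitary : Matrix n n ℂ)) j i)
  rwa [← Matrix.sub_apply, overlapMatrix, ← sub_mul,
    show (hB.1.eigenvectorUnitary : Matrix n n ℂ)ᴴ - (hB.1.eigenvectorUnitary : Matrix n n ℂ)ᴴ * x
      = (hB.1.eigenvectorUnitary : Matrix n n ℂ)ᴴ * (1 - x) by rw [mul_sub, mul_one]] at this

theorem exists_kosaki_eq {A B : Matrix n n ℂ} (hA : A.PosSemidef) (hB : B.PosSemidef) {t : ℝ}
    (ht : 0 < t) : ∃ x : Matrix n n ℂ, kosaki hA.1 hB.1 t =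
      (A * ((1 - x)ᴴ * (1 - x))).trace.re + t⁻¹ * (B * (x * xᴴ)).trace.re := by
  set U := (hA.1.eigenvectorUnitary : Matrix n n ℂ) with hU
  set V := (hB.1.eigenvectorUnitary : Matrix n n ℂ) with hV
  -- The scalar minimiser in each entry, transported back to the original basis below.
  set X : Matrix n n ℂ := Matrix.of fun j i => ((t * hA.1.eigenvalues i /
    (t * hA.1.eigenvalues i + hB.1.eigenvalues j) : ℝ) : ℂ) * overlapMatrix hA.1 hB.1 j i with hX
  refine ⟨V * X * Uᴴ, ?_⟩
  have hVX : Vᴴ * (V * X * Uᴴ) * U = X := by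
    rw [mul_assoc, mul_assoc (V * X), conjTranspose_mul_eigenvectorUnitary hA.1, mul_one,
      ← mul_assoc, conjTranspose_mul_eigenvectorUnitary hB.1, one_mul]
  rw [trace_mul_conjTranspose_mul_self hA.1 hB.1, trace_mul_self_mul_conjTranspose hA.1 hB.1,
    kosaki, ← hU, ← hV, mul_sub, sub_mul, hVX, mul_one]
  simp only [Finset.mul_sum, ← Finset.sum_add_distrib]
  refine Finset.sum_congr rfl fun i _ => Finset.sum_congr rfl fun j _ => ?_
  exact normSq_mul_div_eq (hA.eigenvalues_nonneg i) (hB.eigenvalues_nonneg j) ht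
    (overlapMatrix hA.1 hB.1 j i)

/-! ### Completely positive maps and the Schwarz inequality -/

omit [DecidableEq n] in
-- The argument of `Φ` is `W A Wᴴ`, where `W` stacks the blocks `w p` in a column.
theorem IsCompletelyPositive.comp_posSemidef {Φ : Matrix n n ℂ →ₗ[ℂ] Matrix n n ℂ}
    (hΦ : IsCompletelyPositive Φ) {A : Matrix n n ℂ} (hA : A.PosSemidef) {k : ℕ}
    (w : Fin k → Matrix n n ℂ) :
    (Matrix.comp (Fin k) (Fin k) n n ℂ
      (Matrix.of fun p q => Φ (w p * A * (w q)ᴴ))).PosSemidef := by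
  refine hΦ k (Matrix.of fun p q => w p * A * (w q)ᴴ) ?_
  have h := hA.mul_mul_conjTranspose_same (Matrix.of fun (p : Fin k × n) j => w p.1 p.2 j)
  convert h using 1
  ext ⟨p, i⟩ ⟨q, j⟩
  simp [Matrix.mul_apply]

omit [DecidableEq n] in
theorem IsCompletelyPositive.sum_posSemidef {Φ : Matrix n n ℂ →ₗ[ℂ] Matrix n n ℂ}
    (hΦ : IsCompletelyPositive Φ) {A : Matrix n n ℂ} (hA : A.PosSemidef) {k : ℕ}
    (w y : Fin k → Matrix n n ℂ) :
    (∑ p, ∑ q, y p * Φ (w p * A * (w q)ᴴ) * (y q)ᴴ).PosSemidef := by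
  have h := (hΦ.comp_posSemidef hA w).mul_mul_conjTranspose_same
    (Matrix.of fun i (p : Fin k × n) => y p.1 i p.2)
  convert h using 1
  ext i j
  simp only [Matrix.sum_apply, Matrix.mul_apply, Fintype.sum_prod_type, Matrix.comp_apply,
    Matrix.of_apply, Matrix.conjTranspose_apply, Finset.sum_mul]
  rw [Finset.sum_comm]
  refine Finset.sum_congr rfl fun q _ => ?_
  rw [Finset.sum_comm]

theorem IsCompletelyPositive.posSemidef {Φ : Matrix n n ℂ →ₗ[ℂ] Matrix n n ℂ}
    (hΦ : IsCompletelyPositive Φ) {A : Matrix n n ℂ} (hA : A.PosSemidef) : (Φ A).PosSemidef := by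
  simpa using hΦ.sum_posSemidef hA (k := 1) (fun _ => 1) (fun _ => 1)

/-- The two sides are opposite off-diagonal blocks of a Hermitian `2 × 2` block matrix. -/
theorem IsCompletelyPositive.map_conjTranspose {Φ : Matrix n n ℂ →ₗ[ℂ] Matrix n n ℂ}
    (hΦ : IsCompletelyPositive Φ) {A : Matrix n n ℂ} (hA : A.PosSemidef) (X : Matrix n n ℂ) :
    Φ (A * Xᴴ) = (Φ (X * A))ᴴ := by
  have h := (hΦ.comp_posSemidef hA ![1, X]).1
  ext i j
  have := congrFun (congrFun h (0, i)) (1, j)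
  simpa using this.symm

/-- The dual of a linear map with respect to the trace pairing `(Y, X) ↦ Tr (Y X)`. -/
def traceDual (Φ : Matrix n n ℂ →ₗ[ℂ] Matrix n n ℂ) (Y : Matrix n n ℂ) : Matrix n n ℂ :=
  Matrix.of fun i j => (Y * Φ (Matrix.single j i 1)).trace

theorem trace_traceDual_mul (Φ : Matrix n n ℂ →ₗ[ℂ] Matrix n n ℂ) (Y X : Matrix n n ℂ) :
    (traceDual Φ Y * X).trace = (Y * Φ X).trace := by
  conv_rhs => rw [Matrix.matrix_eq_sum_single X]
  simp only [map_sum, Finset.mul_sum, Matrix.trace_sum]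
  rw [Finset.sum_comm]
  simp only [Matrix.trace, Matrix.diag_apply, Matrix.mul_apply (M := traceDual Φ Y)]
  refine Finset.sum_congr rfl fun i _ => Finset.sum_congr rfl fun j _ => ?_
  have : Matrix.single j i (X j i) = X j i • Matrix.single j i (1 : ℂ) := by
    rw [Matrix.smul_single, smul_eq_mul, mul_one]
  rw [this, map_smul, mul_smul_comm]
  simp [traceDual, Matrix.trace, Finset.mul_sum, mul_comm]

theorem traceDual_sub (Φ : Matrix n n ℂ →ₗ[ℂ] Matrix n n ℂ) (Y Z : Matrix n n ℂ) :
    traceDual Φ (Y - Z) = traceDual Φ Y - traceDual Φ Z :=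
  Matrix.ext_iff_trace_mul_right.mpr fun X => by simp [trace_traceDual_mul, sub_mul]

theorem IsCPTP.traceDual_one {Φ : Matrix n n ℂ →ₗ[ℂ] Matrix n n ℂ} (hΦ : IsCPTP Φ) :
    traceDual Φ 1 = 1 :=
  Matrix.ext_iff_trace_mul_right.mpr fun X => by rw [trace_traceDual_mul, one_mul, one_mul, hΦ.2]

theorem IsCompletelyPositive.traceDual_conjTranspose {Φ : Matrix n n ℂ →ₗ[ℂ] Matrix n n ℂ}
    (hΦ : IsCompletelyPositive Φ) (Y : Matrix n n ℂ) :
    traceDual Φ Yᴴ = (traceDual Φ Y)ᴴ :=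
  Matrix.ext_iff_trace_mul_right.mpr fun X => by
    have h := hΦ.map_conjTranspose Matrix.PosSemidef.one Xᴴ
    rw [one_mul, mul_one, conjTranspose_conjTranspose] at h
    rw [trace_traceDual_mul, h, ← conjTranspose_mul, trace_conjTranspose, trace_mul_comm,
      ← trace_traceDual_mul, ← trace_conjTranspose, conjTranspose_mul,
      conjTranspose_conjTranspose, trace_mul_comm]

/-- The Schwarz inequality for the dual of a completely positive trace preserving map. -/
theorem IsCPTP.schwarz {Φ : Matrix n n ℂ →ₗ[ℂ] Matrix n n ℂ} (hΦ : IsCPTP Φ)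
    {A : Matrix n n ℂ} (hA : A.PosSemidef) (y : Matrix n n ℂ) :
    (A * ((traceDual Φ y)ᴴ * traceDual Φ y)).trace.re ≤ (Φ A * (yᴴ * y)).trace.re := by
  set a := traceDual Φ y with ha
  -- This choice yields `y Φ(A) yᴴ - y Φ(A aᴴ) - Φ(a A) yᴴ + Φ(a A aᴴ)`. The last three terms have
  -- traces of equal real part up to sign, so one copy of `-Tr A aᴴa` survives.
  have h := (hΦ.1.sum_posSemidef hA ![1, a] ![-y, 1]).trace_nonneg
  simp only [Fin.sum_univ_two, Matrix.cons_val_zero, Matrix.cons_val_one, trace_add,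
    conjTranspose_one, one_mul, mul_one, conjTranspose_neg, neg_mul, mul_neg, neg_neg,
    trace_neg] at h
  have h1 : (y * Φ A * yᴴ).trace = (Φ A * (yᴴ * y)).trace := by
    rw [mul_assoc, trace_mul_comm, mul_assoc]
  have h2 : (y * Φ (A * aᴴ)).trace = (A * (aᴴ * a)).trace := by
    rw [← trace_traceDual_mul, trace_mul_comm, mul_assoc]
  have h3 : (Φ (a * A) * yᴴ).trace = star (A * (aᴴ * a)).trace := by
    rw [← h2, hΦ.1.map_conjTranspose hA, ← trace_conjTranspose, conjTranspose_mul,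
      conjTranspose_conjTranspose]
  have h4 : (Φ (a * A * aᴴ)).trace = (A * (aᴴ * a)).trace := by
    rw [hΦ.2, mul_assoc, trace_mul_comm, mul_assoc]
  rw [h1, h2, h3, h4] at h
  have := (Complex.le_def.mp h).1
  simp only [Complex.add_re, Complex.neg_re, Complex.zero_re, RCLike.star_def,
    Complex.conj_re] at this
  linarith

/-- Monotonicity of the Kosaki functional under quantum channels. -/
theorem IsCPTP.kosaki_le_kosaki {Φ : Matrix n n ℂ →ₗ[ℂ] Matrix n n ℂ} (hΦ : IsCPTP Φ)
    {A B : Matrix n n ℂ} (hA : A.PosSemidef) (hB : B.PosSemidef) {t : ℝ} (ht : 0 < t) :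
    kosaki hA.1 hB.1 t ≤ kosaki (hΦ.1.posSemidef hA).1 (hΦ.1.posSemidef hB).1 t := by
  -- The optimal `x` for the outputs, pulled back by the dual, is a competitor for the inputs.
  obtain ⟨x, hx⟩ := exists_kosaki_eq (hΦ.1.posSemidef hA) (hΦ.1.posSemidef hB) ht
  have h1 := hΦ.schwarz hA (1 - x)
  have h2 := hΦ.schwarz hB xᴴ
  rw [traceDual_sub, hΦ.traceDual_one] at h1
  rw [hΦ.1.traceDual_conjTranspose, conjTranspose_conjTranspose, conjTranspose_conjTranspose] at h2
  rw [hx]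
  refine (kosaki_le hA hB ht (traceDual Φ x)).trans (add_le_add h1 ?_)
  exact mul_le_mul_of_nonneg_left h2 (inv_nonneg.mpr ht.le)

/-! ### Support projectors and preservation of supports -/

theorem cfc_mul_cfc (A : Matrix n n ℂ) (f g : ℝ → ℝ) :
    cfc f A * cfc g A = cfc (fun x => f x * g x) A := by
  rw [cfc_mul f g A (A.finite_real_spectrum.continuousOn f)
    (A.finite_real_spectrum.continuousOn g)]

theorem mul_cfc_log {A : Matrix n n ℂ} (hA : A.IsHermitian) :
    A * cfc Real.log A = cfc (fun x => x * Real.log x) A := by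
  rw [← cfc_mul_cfc A, cfc_id_real hA]

theorem one_sub_supportProj {A : Matrix n n ℂ} (hA : A.IsHermitian) :
    1 - supportProj A = cfc (fun x : ℝ => if x = 0 then (1 : ℝ) else 0) A := by
  rw [supportProj, ← cfc_one_real hA, ← cfc_sub _ _ A (A.finite_real_spectrum.continuousOn _)
    (A.finite_real_spectrum.continuousOn _)]
  congr 1
  ext x
  split_ifs <;> simp

theorem trace_mul_cfc {A B : Matrix n n ℂ} (hA : A.IsHermitian) (hB : B.IsHermitian)
    (g : ℝ → ℝ) : (A * cfc g B).trace.re =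
      ∑ i, ∑ j, overlap hA hB i j * (hA.eigenvalues i * g (hB.eigenvalues j)) := by
  have h := trace_cfc_mul_cfc hA hB (fun x => x) g
  rw [cfc_id_real hA] at h
  rw [h, Complex.ofReal_re]

theorem trace_cfc {A B : Matrix n n ℂ} (hA : A.IsHermitian) (hB : B.IsHermitian)
    (f : ℝ → ℝ) : (cfc f A).trace.re =
      ∑ i, ∑ j, overlap hA hB i j * f (hA.eigenvalues i) := by
  have h := trace_cfc_mul_cfc hA hB f (fun _ => 1)
  rw [cfc_one_real hB, mul_one] at h
  rw [h, Complex.ofReal_re]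
  simp

theorem trace_mul_supportProj {A B : Matrix n n ℂ} (hA : A.IsHermitian) (hB : B.IsHermitian) :
    (A * supportProj B).trace.re =
      ∑ i, ∑ j, overlap hA hB i j *
        (hA.eigenvalues i * if hB.eigenvalues j = 0 then 0 else 1) :=
  trace_mul_cfc hA hB _

theorem trace_mul_one_sub_supportProj {A B : Matrix n n ℂ} (hA : A.IsHermitian)
    (hB : B.IsHermitian) : (A * (1 - supportProj B)).trace.re =
      ∑ i, ∑ j, overlap hA hB i j *
        (hA.eigenvalues i * if hB.eigenvalues j = 0 then 1 else 0) := by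
  rw [one_sub_supportProj hB, trace_mul_cfc hA hB]

theorem trace_mul_one_sub_supportProj_nonneg {A B : Matrix n n ℂ} (hA : A.PosSemidef)
    (hB : B.IsHermitian) : 0 ≤ (A * (1 - supportProj B)).trace.re := by
  rw [trace_mul_one_sub_supportProj hA.1 hB]
  refine Finset.sum_nonneg fun i _ => Finset.sum_nonneg fun j _ =>
    mul_nonneg (overlap_nonneg _ _ _ _) (mul_nonneg (hA.eigenvalues_nonneg i) ?_)
  split_ifs <;> norm_num

theorem overlap_mul_eq_zero {A B : Matrix n n ℂ} (hA : A.PosSemidef) (hB : B.IsHermitian)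
    (h : (A * (1 - supportProj B)).trace.re = 0) {i j : n} (hj : hB.eigenvalues j = 0) :
    overlap hA.1 hB i j * hA.1.eigenvalues i = 0 := by
  have h0 : ∀ i j, 0 ≤ overlap hA.1 hB i j *
      (hA.1.eigenvalues i * if hB.eigenvalues j = 0 then 1 else 0) := fun i j =>
    mul_nonneg (overlap_nonneg _ _ _ _) (mul_nonneg (hA.eigenvalues_nonneg i)
      (by split_ifs <;> norm_num))
  rw [trace_mul_one_sub_supportProj hA.1 hB,
    Finset.sum_eq_zero_iff_of_nonneg fun i _ => Finset.sum_nonneg fun j _ => h0 i j] at h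
  have := (Finset.sum_eq_zero_iff_of_nonneg fun j _ => h0 i j).mp (h i (Finset.mem_univ i)) j
    (Finset.mem_univ j)
  simpa [hj] using this

theorem trace_mul_one_sub_supportProj_self {A : Matrix n n ℂ} (hA : A.IsHermitian) :
    (A * (1 - supportProj A)).trace.re = 0 := by
  have h : A * (1 - supportProj A) = 0 := by
    nth_rewrite 1 [← cfc_id_real hA]
    rw [one_sub_supportProj hA, cfc_mul_cfc A]
    convert cfc_zero ℝ A using 2
    ext x
    by_cases hx : x = 0 <;> simp [hx]
  rw [h]
  simp

theorem tendsto_kosaki_zero {A B : Matrix n n ℂ} (hA : A.IsHermitian) (hB : B.IsHermitian) :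
    Tendsto (kosaki hA hB) (𝓝[>] 0) (𝓝 (A * supportProj B).trace.re) := by
  rw [trace_mul_supportProj hA hB]
  refine tendsto_finsetSum _ fun i _ => tendsto_finsetSum _ fun j _ =>
    Tendsto.const_mul _ ?_
  by_cases hj : hB.eigenvalues j = 0
  · simp [hj]
  · have : ContinuousAt (fun t : ℝ => hA.eigenvalues i * hB.eigenvalues j /
        (t * hA.eigenvalues i + hB.eigenvalues j)) 0 :=
      ContinuousAt.div (by fun_prop) (by fun_prop) (by simpa using hj)
    have h2 := this.tendsto.mono_left (nhdsWithin_le_nhds (s := Set.Ioi 0))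
    simpa [hj] using h2

/-- Channels do not move weight out of the support of the reference operator. -/
theorem IsCPTP.trace_mul_one_sub_supportProj_eq_zero {Φ : Matrix n n ℂ →ₗ[ℂ] Matrix n n ℂ}
    (hΦ : IsCPTP Φ) {A B : Matrix n n ℂ} (hA : A.PosSemidef) (hB : B.PosSemidef)
    (h : (A * (1 - supportProj B)).trace.re = 0) :
    (Φ A * (1 - supportProj (Φ B))).trace.re = 0 := by
  refine le_antisymm ?_ (trace_mul_one_sub_supportProj_nonneg (hΦ.1.posSemidef hA)
    (hΦ.1.posSemidef hB).1)
  -- The limit `t ↓ 0` of the Kosaki inequality; equality of traces then bounds the weight off the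
  -- support.
  have h1 : (A * supportProj B).trace.re ≤ (Φ A * supportProj (Φ B)).trace.re := by
    refine le_of_tendsto_of_tendsto (tendsto_kosaki_zero hA.1 hB.1)
      (tendsto_kosaki_zero (hΦ.1.posSemidef hA).1 (hΦ.1.posSemidef hB).1) ?_
    filter_upwards [self_mem_nhdsWithin] with t ht
    exact hΦ.kosaki_le_kosaki hA hB ht
  rw [mul_sub, mul_one, trace_sub, Complex.sub_re] at h ⊢
  rw [hΦ.2]
  linarith

/-! ### Data processing by integrating the Kosaki functional -/

/-- A primitive of `t ↦ kosaki t / t`. -/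
def kosakiPrimitive {A B : Matrix n n ℂ} (hA : A.IsHermitian) (hB : B.IsHermitian) (t : ℝ) : ℝ :=
  ∑ i, ∑ j, overlap hA hB i j * (hA.eigenvalues i *
    (Real.log t - Real.log (t * hA.eigenvalues i + hB.eigenvalues j)))

theorem mul_inv_sub_div_eq {a b t : ℝ} (ht : t ≠ 0) (hs : t * a + b ≠ 0) :
    a * (t⁻¹ - 1 * a / (t * a + b)) = a * b / (t * a + b) / t := by
  rw [one_mul, inv_eq_one_div, div_sub_div _ _ ht hs, div_div, mul_div_assoc',
    div_eq_div_iff (mul_ne_zero ht hs) (mul_ne_zero hs ht)]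
  ring

theorem hasDerivAt_kosakiPrimitive {A B : Matrix n n ℂ} (hA : A.PosSemidef) (hB : B.PosSemidef)
    {t : ℝ} (ht : 0 < t) :
    HasDerivAt (kosakiPrimitive hA.1 hB.1) (kosaki hA.1 hB.1 t / t) t := by
  rw [kosaki, Finset.sum_div]
  refine HasDerivAt.fun_sum fun i _ => ?_
  rw [Finset.sum_div]
  refine HasDerivAt.fun_sum fun j _ => ?_
  rw [mul_div_assoc]
  refine HasDerivAt.const_mul _ ?_
  rcases (hA.eigenvalues_nonneg i).eq_or_lt with hi | hi
  · simpa [← hi] using hasDerivAt_const t (0 : ℝ)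
  · have hj := hB.eigenvalues_nonneg j
    have hs : t * hA.1.eigenvalues i + hB.1.eigenvalues j ≠ 0 := by positivity
    have h1 : HasDerivAt (fun t : ℝ => t * hA.1.eigenvalues i + hB.1.eigenvalues j)
        (1 * hA.1.eigenvalues i) t := ((hasDerivAt_id' t).mul_const _).add_const _
    refine (((Real.hasDerivAt_log ht.ne').sub (h1.log hs)).const_mul _).congr_deriv ?_
    exact mul_inv_sub_div_eq ht.ne' hs

theorem tendsto_kosakiPrimitive_atTop {A B : Matrix n n ℂ} (hA : A.PosSemidef)
    (hB : B.PosSemidef) : Tendsto (kosakiPrimitive hA.1 hB.1) atTop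
      (𝓝 (-(A * cfc Real.log A).trace.re)) := by
  rw [mul_cfc_log hA.1, trace_cfc hA.1 hB.1, ← Finset.sum_neg_distrib]
  refine tendsto_finsetSum _ fun i _ => ?_
  rw [← Finset.sum_neg_distrib]
  refine tendsto_finsetSum _ fun j _ => ?_
  rw [← mul_neg, ← mul_neg]
  refine Tendsto.const_mul _ ?_
  rcases (hA.eigenvalues_nonneg i).eq_or_lt with hi | hi
  · simp [← hi]
  refine Tendsto.const_mul _ ?_
  have hj := hB.eigenvalues_nonneg j
  have h1 : Tendsto (fun t : ℝ => hA.1.eigenvalues i + hB.1.eigenvalues j * t⁻¹) atTop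
      (𝓝 (hA.1.eigenvalues i + hB.1.eigenvalues j * 0)) :=
    (tendsto_inv_atTop_zero.const_mul _).const_add _
  rw [mul_zero, add_zero] at h1
  refine ((h1.log hi.ne').neg).congr' ?_
  filter_upwards [eventually_gt_atTop 0] with t ht
  rw [← Real.log_div ht.ne' (by positivity), ← Real.log_inv]
  congr 1
  field_simp

/-- Subtracting `Tr A · log t` removes the divergence; pairs with zero eigenvalue of `B` carry no
weight by the support hypothesis. -/
theorem tendsto_kosakiPrimitive_zero {A B : Matrix n n ℂ} (hA : A.PosSemidef)
    (hB : B.PosSemidef) (h : (A * (1 - supportProj B)).trace.re = 0) :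
    Tendsto (fun t => kosakiPrimitive hA.1 hB.1 t - A.trace.re * Real.log t) (𝓝[>] 0)
      (𝓝 (-(A * cfc Real.log B).trace.re)) := by
  have htr : A.trace.re = ∑ i, ∑ j, overlap hA.1 hB.1 i j * hA.1.eigenvalues i := by
    rw [← trace_cfc hA.1 hB.1 fun x => x, cfc_id_real hA.1]
  have : ∀ t, kosakiPrimitive hA.1 hB.1 t - A.trace.re * Real.log t =
      ∑ i, ∑ j, overlap hA.1 hB.1 i j * hA.1.eigenvalues i *
        -Real.log (t * hA.1.eigenvalues i + hB.1.eigenvalues j) := fun t => by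
    simp only [htr, kosakiPrimitive, Finset.sum_mul, ← Finset.sum_sub_distrib]
    refine Finset.sum_congr rfl fun i _ => Finset.sum_congr rfl fun j _ => ?_
    ring
  simp only [this]
  rw [trace_mul_cfc hA.1 hB.1, ← Finset.sum_neg_distrib]
  refine tendsto_finsetSum _ fun i _ => ?_
  rw [← Finset.sum_neg_distrib]
  refine tendsto_finsetSum _ fun j _ => ?_
  rw [← mul_assoc, ← mul_neg]
  by_cases hj : hB.1.eigenvalues j = 0
  · simp [overlap_mul_eq_zero hA hB.1 h hj]
  · refine Tendsto.const_mul _ (Tendsto.neg ?_)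
    have hc : ContinuousAt (fun t : ℝ =>
        Real.log (t * hA.1.eigenvalues i + hB.1.eigenvalues j)) 0 :=
      ContinuousAt.log (by fun_prop) (by simpa using hj)
    simpa using hc.tendsto.mono_left (nhdsWithin_le_nhds (s := Set.Ioi 0))

/-- Data processing inequality: quantum channels do not increase the relative entropy. -/
theorem IsCPTP.data_processing {Φ : Matrix n n ℂ →ₗ[ℂ] Matrix n n ℂ}
    (hΦ : IsCPTP Φ) {A B : Matrix n n ℂ} (hA : A.PosSemidef) (hB : B.PosSemidef)
    (h : (A * (1 - supportProj B)).trace.re = 0) :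
    (Φ A * cfc Real.log (Φ A)).trace.re - (Φ A * cfc Real.log (Φ B)).trace.re ≤
      (A * cfc Real.log A).trace.re - (A * cfc Real.log B).trace.re := by
  have hA' := hΦ.1.posSemidef hA
  have hB' := hΦ.1.posSemidef hB
  have h' := hΦ.trace_mul_one_sub_supportProj_eq_zero hA hB h
  -- `H` increases from the difference of the `-Tr A log B` terms at `0` to that of the `-Tr A log
  -- A` terms at infinity. The `log t` divergences cancel because `Φ` preserves the trace.
  set H : ℝ → ℝ := fun t => kosakiPrimitive hA'.1 hB'.1 t - kosakiPrimitive hA.1 hB.1 t with hH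
  have hd : ∀ t : ℝ, 0 < t → HasDerivAt H
      (kosaki hA'.1 hB'.1 t / t - kosaki hA.1 hB.1 t / t) t := fun t ht =>
    (hasDerivAt_kosakiPrimitive hA' hB' ht).sub (hasDerivAt_kosakiPrimitive hA hB ht)
  have hmono : MonotoneOn H (Set.Ioi 0) := by
    refine monotoneOn_of_deriv_nonneg (convex_Ioi 0)
      (fun t ht => (hd t ht).continuousAt.continuousWithinAt)
      (fun t ht => ?_) (fun t ht => ?_)
    · rw [interior_Ioi] at ht
      exact (hd t ht).differentiableAt.differentiableWithinAt
    · rw [interior_Ioi] at ht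
      rw [(hd t ht).deriv, ← sub_div]
      exact div_nonneg (sub_nonneg.mpr (hΦ.kosaki_le_kosaki hA hB ht)) (le_of_lt ht)
  have hle : ∀ s : ℝ, 0 < s → H s ≤
      -(Φ A * cfc Real.log (Φ A)).trace.re - -(A * cfc Real.log A).trace.re := fun s hs => by
    refine ge_of_tendsto ((tendsto_kosakiPrimitive_atTop hA' hB').sub
      (tendsto_kosakiPrimitive_atTop hA hB)) ?_
    filter_upwards [eventually_ge_atTop s] with t hst
    exact hmono hs (lt_of_lt_of_le hs hst) hst
  have h0 : Tendsto H (𝓝[>] 0) (𝓝 (-(Φ A * cfc Real.log (Φ B)).trace.re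
      - -(A * cfc Real.log B).trace.re)) := by
    refine ((tendsto_kosakiPrimitive_zero hA' hB' h').sub
      (tendsto_kosakiPrimitive_zero hA hB h)).congr fun t => ?_
    rw [hΦ.2, hH]
    ring
  have := le_of_tendsto h0 (by
    filter_upwards [self_mem_nhdsWithin] with s hs
    exact hle s hs)
  linarith

/-! ### First-order remainder of the entropy -/

theorem le_mul_log {x m : ℝ} (hx : 0 ≤ x) (hm : 0 < m) :
    x * Real.log m + x - m ≤ x * Real.log x := by
  rcases hx.eq_or_lt with rfl | hx
  · simpa using hm.le
  · have h := Real.log_le_sub_one_of_pos (div_pos hm hx)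
    rw [Real.log_div hm.ne' hx.ne'] at h
    have h2 := mul_le_mul_of_nonneg_left h hx.le
    have h3 : x * (m / x - 1) = m - x := by field_simp
    nlinarith

theorem mul_log_le {x m : ℝ} (hx : 0 ≤ x) (hm : 0 < m) :
    x * Real.log x ≤ x * Real.log m - x + x ^ 2 / m := by
  rcases hx.eq_or_lt with rfl | hx
  · simp
  · have h := Real.log_le_sub_one_of_pos (div_pos hx hm)
    rw [Real.log_div hx.ne' hm.ne'] at h
    have h2 := mul_le_mul_of_nonneg_left h hx.le
    have h3 : x * (x / m - 1) = x ^ 2 / m - x := by ring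
    nlinarith

/-- The summand of the first order remainder of `x * log x`, with the linear term dropped at a
vanishing base point. -/
def bregman (x m : ℝ) : ℝ :=
  x * Real.log x - m * Real.log m - (x - m) * Real.log m - (x - m) * if m = 0 then 0 else 1

/-- For `m > 0` this is convexity. At `m = 0` there is no finite tangent, so the tangent of `x log
x` at a free point `ε` is used instead. -/
theorem le_bregman {x m ε : ℝ} (hx : 0 ≤ x) (hm : 0 ≤ m) (hε : 0 < ε) :
    (x * (Real.log ε + 1) - ε) * (if m = 0 then 1 else 0) ≤ bregman x m := by
  rcases hm.eq_or_lt with rfl | hm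
  · have := le_mul_log hx hε
    simp only [bregman]
    simp
    linarith
  · have := le_mul_log hx hm
    simp only [bregman, hm.ne', if_false]
    linarith

/-- The term `δ⁻¹` serves `m = 0`, where `m⁻¹ = 0` by convention, and `m⁻¹` serves `m > 0`. The free
scale `δ` is matched later to the size of the leakage. -/
theorem bregman_le {x m δ : ℝ} (hx : 0 ≤ x) (hm : 0 ≤ m) (hδ : 0 < δ) :
    bregman x m ≤ x * (Real.log δ - 1) * (if m = 0 then 1 else 0)
      + (x - m) ^ 2 * (δ⁻¹ + m⁻¹) := by
  rcases hm.eq_or_lt with rfl | hm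
  · have := mul_log_le hx hδ
    simp only [bregman]
    simp
    rw [div_eq_mul_inv] at this
    linarith
  · have h1 := mul_log_le hx hm
    have h2 : 0 ≤ (x - m) ^ 2 * δ⁻¹ := by positivity
    have h3 : (x - m) ^ 2 * m⁻¹ = x ^ 2 / m - 2 * x + m := by field_simp; ring
    simp only [bregman, hm.ne', if_false]
    rw [mul_add, h3]
    linarith

theorem trace_cfc_right {A B : Matrix n n ℂ} (hA : A.IsHermitian) (hB : B.IsHermitian)
    (g : ℝ → ℝ) : (cfc g B).trace.re = ∑ i, ∑ j, overlap hA hB i j * g (hB.eigenvalues j) := by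
  have h := trace_cfc_mul_cfc hA hB (fun _ => 1) g
  rw [cfc_one_real hA, one_mul] at h
  rw [h, Complex.ofReal_re]
  simp

/-- The first order remainder of `A ↦ Tr (A log A)` at `B`. -/
def entropyRemainder (A B : Matrix n n ℂ) : ℝ :=
  (A * cfc Real.log A).trace.re - (B * cfc Real.log B).trace.re
    - ((A - B) * cfc Real.log B).trace.re - ((A - B) * supportProj B).trace.re

theorem trace_sub_mul_cfc {A B : Matrix n n ℂ} (hA : A.IsHermitian) (hB : B.IsHermitian)
    (g : ℝ → ℝ) : ((A - B) * cfc g B).trace.re =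
      ∑ i, ∑ j, overlap hA hB i j *
        ((hA.eigenvalues i - hB.eigenvalues j) * g (hB.eigenvalues j)) := by
  have h : (B * cfc g B).trace.re =
      ∑ i, ∑ j, overlap hA hB i j * (hB.eigenvalues j * g (hB.eigenvalues j)) := by
    nth_rewrite 1 [← cfc_id_real hB]
    rw [cfc_mul_cfc, trace_cfc_right hA hB]
  rw [sub_mul, trace_sub, Complex.sub_re, h, trace_mul_cfc hA hB]
  simp only [← Finset.sum_sub_distrib]
  refine Finset.sum_congr rfl fun i _ => Finset.sum_congr rfl fun j _ => ?_
  ring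

theorem trace_sub_mul_sub {A B : Matrix n n ℂ} (hA : A.IsHermitian) (hB : B.IsHermitian) :
    ((A - B) * (A - B)).trace.re =
      ∑ i, ∑ j, overlap hA hB i j * (hA.eigenvalues i - hB.eigenvalues j) ^ 2 := by
  have h1 : (A * A).trace.re = ∑ i, ∑ j, overlap hA hB i j *
      (hA.eigenvalues i * hA.eigenvalues i) := by
    rw [← trace_cfc hA hB fun x => x * x, ← cfc_mul_cfc, cfc_id_real hA]
  have h2 : (B * A).trace.re = ∑ i, ∑ j, overlap hA hB i j *
      (hA.eigenvalues i * hB.eigenvalues j) := by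
    rw [trace_mul_comm, ← trace_mul_cfc hA hB fun x => x, cfc_id_real hB]
  have h3 := trace_sub_mul_cfc hA hB fun x => x
  rw [cfc_id_real hB] at h3
  rw [mul_sub, trace_sub, Complex.sub_re, h3, sub_mul, trace_sub, Complex.sub_re, h1, h2]
  simp only [← Finset.sum_sub_distrib]
  refine Finset.sum_congr rfl fun i _ => Finset.sum_congr rfl fun j _ => ?_
  ring

theorem entropyRemainder_eq {A B : Matrix n n ℂ} (hA : A.IsHermitian) (hB : B.IsHermitian) :
    entropyRemainder A B = ∑ i, ∑ j, overlap hA hB i j *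
      bregman (hA.eigenvalues i) (hB.eigenvalues j) := by
  rw [entropyRemainder, mul_cfc_log hA, mul_cfc_log hB, trace_cfc hA hB, trace_cfc_right hA hB,
    trace_sub_mul_cfc hA hB, supportProj, trace_sub_mul_cfc hA hB]
  simp only [← Finset.sum_sub_distrib]
  refine Finset.sum_congr rfl fun i _ => Finset.sum_congr rfl fun j _ => ?_
  rw [bregman]
  ring

theorem le_entropyRemainder {A B : Matrix n n ℂ} (hA : A.PosSemidef) (hB : B.PosSemidef) {ε : ℝ}
    (hε : 0 < ε) :
    (A * (1 - supportProj B)).trace.re * (Real.log ε + 1)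
      - (1 - supportProj B).trace.re * ε ≤ entropyRemainder A B := by
  rw [entropyRemainder_eq hA.1 hB.1, trace_mul_one_sub_supportProj hA.1 hB.1,
    one_sub_supportProj hB.1, trace_cfc_right hA.1 hB.1]
  simp only [Finset.sum_mul, ← Finset.sum_sub_distrib]
  refine Finset.sum_le_sum fun i _ => Finset.sum_le_sum fun j _ => ?_
  have := mul_le_mul_of_nonneg_left (le_bregman (hA.eigenvalues_nonneg i)
    (hB.eigenvalues_nonneg j) hε) (overlap_nonneg hA.1 hB.1 i j)
  linarith

theorem entropyRemainder_le {A B : Matrix n n ℂ} (hA : A.PosSemidef) (hB : B.PosSemidef) {δ : ℝ}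
    (hδ : 0 < δ) :
    entropyRemainder A B ≤ (A * (1 - supportProj B)).trace.re * (Real.log δ - 1)
      + ((A - B) * (A - B)).trace.re * (δ⁻¹ + ∑ j, (hB.1.eigenvalues j)⁻¹) := by
  rw [entropyRemainder_eq hA.1 hB.1, trace_mul_one_sub_supportProj hA.1 hB.1,
    trace_sub_mul_sub hA.1 hB.1]
  simp only [Finset.sum_mul, ← Finset.sum_add_distrib]
  refine Finset.sum_le_sum fun i _ => Finset.sum_le_sum fun j _ => ?_
  have h1 := mul_le_mul_of_nonneg_left (bregman_le (hA.eigenvalues_nonneg i)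
    (hB.eigenvalues_nonneg j) hδ) (overlap_nonneg hA.1 hB.1 i j)
  have h2 : (hB.1.eigenvalues j)⁻¹ ≤ ∑ j, (hB.1.eigenvalues j)⁻¹ :=
    Finset.single_le_sum (f := fun j => (hB.1.eigenvalues j)⁻¹)
      (fun j _ => inv_nonneg.mpr (hB.eigenvalues_nonneg j)) (Finset.mem_univ j)
  have h3 := mul_le_mul_of_nonneg_left h2 (mul_nonneg (overlap_nonneg hA.1 hB.1 i j)
    (sq_nonneg (hA.1.eigenvalues i - hB.1.eigenvalues j)))
  linarith

/-! ### Semigroups as exponentials of their generators -/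

section BanachAlgebra

variable {𝔸 : Type*} [NormedRing 𝔸] [NormedAlgebra ℝ 𝔸] [CompleteSpace 𝔸]

theorem norm_one_add_pow_sub_one_le {R : Type*} [NormedRing R] (x : R) (N : ℕ) :
    ‖(1 + x) ^ N - 1‖ ≤ (1 + ‖x‖) ^ N - 1 := by
  induction N with
  | zero => simp
  | succ N ih =>
    have h : (1 + x) ^ (N + 1) - 1 = ((1 + x) ^ N - 1) + ((1 + x) ^ N - 1) * x + x := by
      rw [pow_succ]; noncomm_ring
    rw [h]
    have h1 := norm_add_le (((1 + x) ^ N - 1) + ((1 + x) ^ N - 1) * x) x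
    have h2 := norm_add_le ((1 + x) ^ N - 1) (((1 + x) ^ N - 1) * x)
    have h3 := norm_mul_le ((1 + x) ^ N - 1) x
    have h4 := mul_le_mul_of_nonneg_right ih (norm_nonneg x)
    rw [pow_succ]
    nlinarith

/-- A one-parameter semigroup whose right derivative at zero vanishes is trivial. -/
theorem eq_one_of_semigroup_of_hasDeriv_zero {R : Type*} [NormedRing R] [NormedAlgebra ℝ R]
    (U : ℝ → R) (h0 : U 0 = 1)
    (hadd : ∀ s t, 0 ≤ s → 0 ≤ t → U (s + t) = U s * U t)
    (hU : HasDerivWithinAt U 0 (Set.Ioi 0) 0) {t : ℝ} (ht : 0 ≤ t) : U t = 1 := by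
  have hpow : ∀ s : ℝ, 0 ≤ s → ∀ N : ℕ, U (N * s) = U s ^ N := fun s hs N => by
    induction N with
    | zero => simp [h0]
    | succ N ih =>
      rw [pow_succ, ← ih, ← hadd _ _ (by positivity) hs]
      congr 1
      push_cast
      ring
  -- Cut `[0, t]` into `N + 1` equal steps, each within `ε t/(N+1)` of the identity, and use `1 + x
  -- ≤ exp x`.
  have key : ∀ ε : ℝ, 0 < ε → ‖U t - 1‖ ≤ Real.exp (ε * t) - 1 := fun ε hε => by
    rcases ht.eq_or_lt with rfl | htp
    · simp [h0]
    have h1 : ∀ᶠ h in 𝓝[>] (0 : ℝ), ‖U h - 1‖ ≤ ε * h := by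
      have := (hasDerivWithinAt_iff_isLittleO.mp hU).bound hε
      filter_upwards [this, self_mem_nhdsWithin] with h hh hpos
      simpa [h0, abs_of_pos (show 0 < h from hpos)] using hh
    have h2 : Tendsto (fun N : ℕ => t / (N + 1 : ℝ)) atTop (𝓝[>] 0) := by
      refine tendsto_nhdsWithin_iff.mpr ⟨?_, Eventually.of_forall fun N => ?_⟩
      · exact (tendsto_const_div_atTop_nhds_zero_nat t).comp (tendsto_add_atTop_nat 1) |>.congr
          fun N => by simp
      · exact div_pos htp (by positivity)
    obtain ⟨N, hN⟩ := (h2.eventually h1).exists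
    have h3 : U t = U (t / (N + 1 : ℝ)) ^ (N + 1) := by
      rw [← hpow _ (by positivity)]
      congr 1
      push_cast
      field_simp
    have h4 := norm_one_add_pow_sub_one_le (U (t / (N + 1 : ℝ)) - 1) (N + 1)
    rw [add_sub_cancel, ← h3] at h4
    refine h4.trans (sub_le_sub_right ?_ 1)
    calc (1 + ‖U (t / (N + 1 : ℝ)) - 1‖) ^ (N + 1)
        ≤ Real.exp (ε * (t / (N + 1 : ℝ))) ^ (N + 1) := by
          refine pow_le_pow_left₀ (by positivity) ?_ _
          have := Real.add_one_le_exp (ε * (t / (N + 1 : ℝ)))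
          linarith
      _ = Real.exp (ε * t) := by
          rw [← Real.exp_nat_mul]
          congr 1
          push_cast
          field_simp
  have h5 : Tendsto (fun ε : ℝ => Real.exp (ε * t) - 1) (𝓝[>] 0) (𝓝 0) := by
    have : Continuous fun ε : ℝ => Real.exp (ε * t) - 1 := by fun_prop
    simpa using (this.tendsto 0).mono_left (nhdsWithin_le_nhds (s := Set.Ioi 0))
  have h6 : ‖U t - 1‖ ≤ 0 := ge_of_tendsto h5 (by
    filter_upwards [self_mem_nhdsWithin] with ε hε
    exact key ε hε)
  exact sub_eq_zero.mp (norm_le_zero_iff.mp h6)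

open NormedSpace in
/-- A differentiable one-parameter semigroup is the exponential of its generator. -/
theorem eq_exp_of_semigroup (T : ℝ → 𝔸) (L : 𝔸) (h0 : T 0 = 1)
    (hadd : ∀ s t, 0 ≤ s → 0 ≤ t → T (s + t) = T s * T t)
    (hT : Tendsto (fun h : ℝ => h⁻¹ • (T h - 1)) (𝓝[>] 0) (𝓝 L)) {t : ℝ} (ht : 0 ≤ t) :
    T t = exp (t • L) := by
  -- Both products are limits of `h⁻¹ • (T (s + h) - T s)`.
  have hcomm : ∀ s, 0 ≤ s → Commute L (T s) := fun s hs => by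
    refine tendsto_nhds_unique (hT.mul_const (T s)) ((hT.const_mul (T s)).congr' ?_)
    filter_upwards [self_mem_nhdsWithin] with h hh
    rw [mul_smul_comm, smul_mul_assoc, mul_sub, sub_mul, ← hadd s h hs (le_of_lt hh),
      ← hadd h s (le_of_lt hh) hs, add_comm, mul_one, one_mul]
  have hexp : ∀ s t : ℝ, exp ((s + t) • L) = exp (s • L) * exp (t • L) := fun s t => by
    let : NormedAlgebra ℚ 𝔸 := NormedAlgebra.restrictScalars ℚ ℝ 𝔸
    rw [add_smul, exp_add_of_commute (((Commute.refl L).smul_left s).smul_right t)]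
  have hderT : HasDerivWithinAt T L (Set.Ioi 0) 0 := by
    rw [hasDerivWithinAt_iff_tendsto_slope' (by simp)]
    refine hT.congr fun h => ?_
    rw [slope_def_module, h0, sub_zero]
  have hderE : HasDerivWithinAt (fun s : ℝ => exp (s • (-L))) (-L) (Set.Ioi 0) 0 := by
    have := hasDerivAt_exp_smul_const (𝕂 := ℝ) (-L) (0 : ℝ)
    rw [zero_smul, exp_zero, one_mul] at this
    exact this.hasDerivWithinAt
  have hexp' : ∀ s : ℝ, exp (s • (-L)) = exp ((-s) • L) := fun s => by rw [smul_neg, neg_smul]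
  -- By commutation `exp (-sL) * T s` is again a semigroup, and its right derivative at zero is `-L
  -- + L = 0`.
  have hU := eq_one_of_semigroup_of_hasDeriv_zero (fun s => exp (s • (-L)) * T s)
    (by simp [h0]) (fun s t hs ht => by
      simp only [hexp', neg_add, hexp, hadd s t hs ht]
      have : Commute (exp ((-t) • L)) (T s) := ((hcomm s hs).smul_left (-t)).exp_left
      simp only [mul_assoc]
      rw [← mul_assoc (exp ((-t) • L)) (T s), this.eq, mul_assoc])
    ((hderE.mul hderT).congr_deriv (by simp [h0])) ht
  have h1 : exp (t • L) * exp ((-t) • L) = 1 := by rw [← hexp, add_neg_cancel, zero_smul, exp_zero]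
  have h2 : exp ((-t) • L) * T t = 1 := by rw [← hexp']; exact hU
  calc T t = (exp (t • L) * exp ((-t) • L)) * T t := by rw [h1, one_mul]
    _ = exp (t • L) := by rw [mul_assoc, h2, mul_one]

open NormedSpace in
/-- Second order Taylor expansion of the exponential. -/
theorem tendsto_exp_smul_sub (L : 𝔸) :
    Tendsto (fun h : ℝ => (h ^ 2)⁻¹ • (exp (h • L) - 1 - h • L)) (𝓝[≠] 0)
      (𝓝 ((2 : ℝ)⁻¹ • L ^ 2)) := by
  have h1 := (exp_hasFPowerSeriesAt_zero (𝕂 := ℝ) (𝔸 := 𝔸)).isBigO_sub_partialSum_pow 3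
  have h2 : Tendsto (fun h : ℝ => h • L) (𝓝[≠] 0) (𝓝 0) := by
    have : Continuous fun h : ℝ => h • L := by fun_prop
    simpa using (this.tendsto 0).mono_left (nhdsWithin_le_nhds (s := {0}ᶜ))
  obtain ⟨C, hC⟩ := (h1.comp_tendsto h2).bound
  rw [tendsto_iff_norm_sub_tendsto_zero]
  have h3 : Tendsto (fun h : ℝ => C * ‖L‖ ^ 3 * |h|) (𝓝[≠] 0) (𝓝 0) := by
    have : Continuous fun h : ℝ => C * ‖L‖ ^ 3 * |h| := by fun_prop
    simpa using (this.tendsto 0).mono_left (nhdsWithin_le_nhds (s := {0}ᶜ))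
  refine squeeze_zero' (Eventually.of_forall fun _ => norm_nonneg _) ?_ h3
  filter_upwards [hC, self_mem_nhdsWithin] with h hh hne
  have hne' : h ≠ 0 := hne
  simp only [Function.comp_apply, zero_add, FormalMultilinearSeries.partialSum,
    Finset.sum_range_succ, Finset.sum_range_zero, expSeries_apply_eq] at hh
  have h4 : (h ^ 2)⁻¹ • (exp (h • L) - 1 - h • L) - (2 : ℝ)⁻¹ • L ^ 2 = (h ^ 2)⁻¹ •
      (exp (h • L) - (1 + h • L + (2 : ℝ)⁻¹ • (h • L) ^ 2)) := by
    rw [smul_pow, smul_comm (2 : ℝ)⁻¹, ← sub_sub, ← sub_sub, smul_sub _ _ (h ^ 2 • _), smul_smul,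
      inv_mul_cancel₀ (by positivity), one_smul]
  rw [h4, norm_smul, norm_inv, norm_pow, Real.norm_eq_abs, inv_mul_le_iff₀ (by positivity)]
  simp [norm_smul] at hh
  exact hh.trans_eq (by ring)

end BanachAlgebra

section FiniteDimensional

variable {E : Type*} [NormedAddCommGroup E] [NormedSpace ℝ E] [FiniteDimensional ℝ E]

/-- In finite dimension an operator is determined, homeomorphically, by its values on a basis. -/
theorem tendsto_clm_of_forall_tendsto_apply {α : Type*} {l : Filter α} {f : α → E →L[ℝ] E}
    {g : E →L[ℝ] E} (h : ∀ x, Tendsto (fun a => f a x) l (𝓝 (g x))) : Tendsto f l (𝓝 g) := by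
  let e : (E →L[ℝ] E) ≃L[ℝ] Fin (Module.finrank ℝ E) → E :=
    ((ContinuousLinearEquiv.ofFinrankEq (Module.finrank_fin_fun ℝ).symm).arrowCongr
      (1 : E ≃L[ℝ] E)).trans (ContinuousLinearEquiv.piRing _)
  rw [e.toHomeomorph.isInducing.tendsto_nhds_iff]
  exact tendsto_pi_nhds.mpr fun i => h _

open NormedSpace in
/-- A differentiable semigroup on a finite-dimensional space extends to a group with a second
order expansion at zero, and it fixes the kernel of its generator. -/
theorem exists_group_of_semigroup (T : ℝ → E →ₗ[ℝ] E) (L : E →ₗ[ℝ] E) (h0 : T 0 = LinearMap.id)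
    (hadd : ∀ s t, 0 ≤ s → 0 ≤ t → T (s + t) = T s ∘ₗ T t)
    (hT : ∀ x, Tendsto (fun h : ℝ => h⁻¹ • (T h x - x)) (𝓝[>] 0) (𝓝 (L x))) :
    ∃ R : ℝ → E →ₗ[ℝ] E, (∀ t, 0 ≤ t → T t = R t) ∧ (∀ s t x, R (s + t) x = R s (R t x)) ∧
      (∀ t x, L x = 0 → R t x = x) ∧
      ∀ x, ∃ y, Tendsto (fun h : ℝ => (h ^ 2)⁻¹ • (R h x - x - h • L x)) (𝓝[≠] 0) (𝓝 y) := by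
  have : CompleteSpace E := FiniteDimensional.complete ℝ E
  set T' : ℝ → E →L[ℝ] E := fun t => (T t).toContinuousLinearMap with hT'
  set L' : E →L[ℝ] E := L.toContinuousLinearMap with hL'
  have hexp : ∀ t, 0 ≤ t → T' t = exp (t • L') := fun t ht => by
    refine eq_exp_of_semigroup T' L' ?_ (fun s t hs ht => ?_) ?_ ht
    · ext x; simp [hT', h0]
    · ext x; simp [hT', hadd s t hs ht]
    · exact tendsto_clm_of_forall_tendsto_apply fun x => by simpa [hT', hL'] using hT x
  refine ⟨fun t => (exp (t • L') : E →L[ℝ] E), fun t ht => ?_, fun s t x => ?_, fun t x hx => ?_,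
    fun x => ⟨((2 : ℝ)⁻¹ • L' ^ 2 : E →L[ℝ] E) x, ?_⟩⟩
  · beta_reduce
    rw [← hexp t ht]
    rfl
  · let : NormedAlgebra ℚ (E →L[ℝ] E) := NormedAlgebra.restrictScalars ℚ ℝ (E →L[ℝ] E)
    beta_reduce
    rw [add_smul, exp_add_of_commute (((Commute.refl L').smul_left s).smul_right t)]
    rfl
  · have hd : ∀ s : ℝ, HasDerivAt (fun s : ℝ => (exp (s • L') : E →L[ℝ] E) x) 0 s := fun s => by
      have := (hasDerivAt_exp_smul_const (𝕂 := ℝ) L' s).clm_apply (hasDerivAt_const s x)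
      have hx' : L' x = 0 := hx
      simpa [hx'] using this
    have := is_const_of_deriv_eq_zero (fun s => (hd s).differentiableAt) (fun s => (hd s).deriv) t 0
    simpa using this
  · have := ((ContinuousLinearMap.apply ℝ E x).continuous.tendsto _).comp (tendsto_exp_smul_sub L')
    exact this

end FiniteDimensional

section Norm

attribute [local instance] Matrix.normedAddCommGroup Matrix.normedSpace

omit [DecidableEq n] in
theorem IsDynamicalSemigroup.exists_group {T : ℝ → (Matrix n n ℂ →ₗ[ℂ] Matrix n n ℂ)}
    (hT : IsDynamicalSemigroup T) {L : Matrix n n ℂ →ₗ[ℂ] Matrix n n ℂ} (hL : IsGenerator T L) :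
    ∃ R : ℝ → Matrix n n ℂ →ₗ[ℝ] Matrix n n ℂ, (∀ t, 0 ≤ t → ∀ X, T t X = R t X) ∧
      (∀ s t X, R (s + t) X = R s (R t X)) ∧ (∀ t X, L X = 0 → R t X = X) ∧
      ∀ X, ∃ Y, Tendsto (fun h : ℝ => (h ^ 2)⁻¹ • (R h X - X - h • L X)) (𝓝[≠] 0) (𝓝 Y) := by
  obtain ⟨R, h1, h2, h3, h4⟩ := exists_group_of_semigroup (fun t => (T t).restrictScalars ℝ)
    (L.restrictScalars ℝ) (by rw [hT.zero]; rfl)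
    (fun s t hs ht => by rw [hT.add s t hs ht]; rfl) hL
  exact ⟨R, fun t ht X => LinearMap.congr_fun (h1 t ht) X, h2, h3, h4⟩

end Norm

/-- The increments `h` for which time `t + h` is admissible. -/
abbrev increments (t : ℝ) : Filter ℝ := 𝓝[{h : ℝ | h ≠ 0 ∧ 0 ≤ t + h}] 0

omit [DecidableEq n] in
theorem IsDynamicalSemigroup.apply_eq_of_generator_eq_zero
    {T : ℝ → (Matrix n n ℂ →ₗ[ℂ] Matrix n n ℂ)}
    (hT : IsDynamicalSemigroup T) {L : Matrix n n ℂ →ₗ[ℂ] Matrix n n ℂ} (hL : IsGenerator T L)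
    {X : Matrix n n ℂ} (hX : L X = 0) {t : ℝ} (ht : 0 ≤ t) : T t X = X := by
  obtain ⟨R, h1, -, h3, -⟩ := hT.exists_group hL
  rw [h1 t ht, h3 t X hX]

omit [DecidableEq n] in
/-- Second order expansion of the trajectories of a quantum dynamical semigroup. -/
theorem IsDynamicalSemigroup.exists_tendsto_taylor {T : ℝ → (Matrix n n ℂ →ₗ[ℂ] Matrix n n ℂ)}
    (hT : IsDynamicalSemigroup T) {L : Matrix n n ℂ →ₗ[ℂ] Matrix n n ℂ} (hL : IsGenerator T L)
    (X : Matrix n n ℂ) {t : ℝ} (ht : 0 ≤ t) :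
    ∃ Y, Tendsto (fun h : ℝ => (h ^ 2)⁻¹ • (T (t + h) X - T t X - h • L (T t X)))
      (increments t) (𝓝 Y) := by
  obtain ⟨R, h1, h2, -, h4⟩ := hT.exists_group hL
  obtain ⟨Y, hY⟩ := h4 (T t X)
  refine ⟨Y, (hY.mono_left (nhdsWithin_mono 0 fun h hh => hh.1)).congr' ?_⟩
  filter_upwards [self_mem_nhdsWithin] with h hh
  rw [h1 (t + h) hh.2, add_comm t h, h2, ← h1 t ht]

/-! ### Leakage and entropy along a curve of states -/

section Curve

variable {F : Filter ℝ} {A : ℝ → Matrix n n ℂ} {B M Y : Matrix n n ℂ}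

omit [Fintype n] [DecidableEq n] in
theorem tendsto_slope_of_taylor (hF : F ≤ 𝓝[≠] 0)
    (hY : Tendsto (fun h : ℝ => (h ^ 2)⁻¹ • (A h - B - h • M)) F (𝓝 Y)) :
    Tendsto (fun h : ℝ => h⁻¹ • (A h - B)) F (𝓝 M) := by
  have h0 : Tendsto (fun h : ℝ => h) F (𝓝 0) := hF.trans nhdsWithin_le_nhds
  have h1 := (h0.smul hY).const_add M
  rw [zero_smul, add_zero] at h1
  refine h1.congr' ?_
  filter_upwards [hF self_mem_nhdsWithin] with h hh
  have hh' : h ≠ 0 := hh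
  rw [smul_smul, show h * (h ^ 2)⁻¹ = h⁻¹ by field_simp, smul_sub _ _ (h • M), smul_smul,
    inv_mul_cancel₀ hh', one_smul, add_sub_cancel]

theorem tendsto_trace_slope_mul (h : Tendsto (fun h : ℝ => h⁻¹ • (A h - B)) F (𝓝 M))
    (C : Matrix n n ℂ) :
    Tendsto (fun h : ℝ => (h : ℂ)⁻¹ * ((A h - B) * C).trace) F (𝓝 (M * C).trace) := by
  have hc : Continuous fun X : Matrix n n ℂ => (X * C).trace :=
    (continuous_id.matrix_mul continuous_const).matrix_trace
  refine ((hc.tendsto M).comp h).congr fun h => ?_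
  simp only [Function.comp_apply, smul_mul_assoc, trace_smul, Complex.real_smul,
    Complex.ofReal_inv]

theorem tendsto_re_trace_slope_mul (h : Tendsto (fun h : ℝ => h⁻¹ • (A h - B)) F (𝓝 M))
    (C : Matrix n n ℂ) :
    Tendsto (fun h : ℝ => ((A h - B) * C).trace.re / h) F (𝓝 (M * C).trace.re) := by
  refine ((Complex.continuous_re.tendsto _).comp (tendsto_trace_slope_mul h C)).congr fun h => ?_
  rw [Function.comp_apply, ← Complex.ofReal_inv, Complex.re_ofReal_mul, div_eq_inv_mul]

theorem tendsto_trace_sq_div (h : Tendsto (fun h : ℝ => h⁻¹ • (A h - B)) F (𝓝 M)) :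
    Tendsto (fun h : ℝ => ((A h - B) * (A h - B)).trace.re / h ^ 2) F (𝓝 (M * M).trace.re) := by
  have hc : Continuous fun X : Matrix n n ℂ => (X * X).trace.re :=
    Complex.continuous_re.comp (continuous_id.matrix_mul continuous_id).matrix_trace
  refine ((hc.tendsto M).comp h).congr fun h => ?_
  rw [Function.comp_apply, smul_mul_smul_comm, trace_smul, Complex.smul_re, smul_eq_mul,
    div_eq_inv_mul, ← pow_two, inv_pow]

theorem re_trace_mul_one_sub_supportProj_sub (hB : B.IsHermitian) (X : Matrix n n ℂ) :
    ((X - B) * (1 - supportProj B)).trace.re = (X * (1 - supportProj B)).trace.re := by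
  rw [sub_mul, trace_sub, Complex.sub_re, trace_mul_one_sub_supportProj_self hB, sub_zero]

/-- The leakage is linear and vanishes on both `B` and `M`, so only the second-order term survives.
-/
theorem tendsto_leakage_div_sq (hB : B.IsHermitian)
    (hY : Tendsto (fun h : ℝ => (h ^ 2)⁻¹ • (A h - B - h • M)) F (𝓝 Y))
    (hM : (M * (1 - supportProj B)).trace.re = 0) :
    Tendsto (fun h : ℝ => (A h * (1 - supportProj B)).trace.re / h ^ 2) F
      (𝓝 (Y * (1 - supportProj B)).trace.re) := by
  have hc : Continuous fun X : Matrix n n ℂ => (X * (1 - supportProj B)).trace.re :=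
    Complex.continuous_re.comp (continuous_id.matrix_mul continuous_const).matrix_trace
  refine ((hc.tendsto Y).comp hY).congr fun h => ?_
  rw [Function.comp_apply, smul_mul_assoc, trace_smul, Complex.smul_re, sub_mul, trace_sub,
    Complex.sub_re, smul_mul_assoc, trace_smul, Complex.smul_re, hM, smul_zero, sub_zero,
    re_trace_mul_one_sub_supportProj_sub hB, smul_eq_mul, div_eq_inv_mul]

/-- If no weight flows into the kernel of `B` to first order, then `Tr (A log A)` has a finite
derivative at `B`. -/
theorem tendsto_entropyRemainder_div_zero (hF : F ≤ 𝓝[≠] 0) (hB : B.PosSemidef)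
    (hA : ∀ᶠ h in F, (A h).PosSemidef)
    (hY : Tendsto (fun h : ℝ => (h ^ 2)⁻¹ • (A h - B - h • M)) F (𝓝 Y))
    (hM : (M * (1 - supportProj B)).trace.re = 0) :
    Tendsto (fun h : ℝ => entropyRemainder (A h) B / h) F (𝓝 0) := by
  obtain ⟨C, hC⟩ : ∃ C, C = ∑ j, (hB.1.eigenvalues j)⁻¹ := ⟨_, rfl⟩
  obtain ⟨m, hm⟩ : ∃ m, m = (1 - supportProj B).trace.re := ⟨_, rfl⟩
  have hid : Tendsto (fun h : ℝ => h) F (𝓝 0) := hF.trans nhdsWithin_le_nhds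
  have habs : Tendsto (fun h : ℝ => |h|) F (𝓝 0) := by simpa using hid.abs
  have hw := tendsto_leakage_div_sq hB.1 hY hM
  have hN := tendsto_trace_sq_div (tendsto_slope_of_taylor hF hY)
  have hlog : Tendsto (fun h : ℝ => |h| * (Real.log (h ^ 2) + 1)) F (𝓝 0) := by
    have h1 : Continuous fun h : ℝ => 2 * (|h| * Real.log |h|) + |h| :=
      ((Real.continuous_mul_log.comp continuous_abs).const_mul 2).add continuous_abs
    have h2 := (h1.tendsto 0).comp hid
    simp only [abs_zero, zero_mul, mul_zero, add_zero] at h2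
    refine h2.congr fun h => ?_
    rw [Function.comp_apply, Real.log_pow, Real.log_abs]
    push_cast
    ring
  have hup : Tendsto (fun h : ℝ => ((A h - B) * (A h - B)).trace.re / h ^ 2 * (|h| * (1 + C))) F
      (𝓝 0) := by
    simpa using hN.mul (habs.mul_const (1 + C))
  have hlow : Tendsto (fun h : ℝ => (A h * (1 - supportProj B)).trace.re / h ^ 2 *
      (|h| * (Real.log (h ^ 2) + 1)) - m * |h|) F (𝓝 0) := by
    simpa using (hw.mul hlog).sub (habs.const_mul m)
  -- Increments may be negative, so the squeeze is done with `|h|`.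
  have key : Tendsto (fun h : ℝ => entropyRemainder (A h) B / |h|) F (𝓝 0) := by
    refine tendsto_of_tendsto_of_tendsto_of_le_of_le' hlow hup ?_ ?_
    · filter_upwards [hA, hF self_mem_nhdsWithin] with h hAh hh
      have hpos : 0 < |h| := abs_pos.mpr hh
      -- With `ε = h²`, leakage of order `h²` contributes `h² log h²`, and `m * ε` is also `o(h)`.
      have h1 := le_entropyRemainder hAh hB (pow_pos hpos 2)
      rw [sq_abs, ← hm] at h1
      rw [le_div_iff₀ hpos]
      refine le_trans (le_of_eq ?_) h1
      rw [← sq_abs h]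
      field_simp
    · filter_upwards [hA, hF self_mem_nhdsWithin] with h hAh hh
      have hpos : 0 < |h| := abs_pos.mpr hh
      have h1 := entropyRemainder_le hAh hB (δ := 1) one_pos
      have h2 := trace_mul_one_sub_supportProj_nonneg hAh hB.1
      rw [Real.log_one, inv_one, ← hC] at h1
      rw [div_le_iff₀ hpos, ← sq_abs h]
      have h3 : ((A h - B) * (A h - B)).trace.re / |h| ^ 2 * (|h| * (1 + C)) * |h| =
          ((A h - B) * (A h - B)).trace.re * (1 + C) := by
        field_simp
      rw [h3]
      linarith
  rw [tendsto_zero_iff_abs_tendsto_zero] at key ⊢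
  refine key.congr fun h => ?_
  simp [abs_div]

/-- If weight flows into the kernel of `B` to first order, then `Tr (A log A)` has derivative `-∞`
at `B`. -/
theorem tendsto_entropyRemainder_div_atBot (hF : F ≤ 𝓝[>] 0) (hB : B.PosSemidef)
    (hA : ∀ᶠ h in F, (A h).PosSemidef)
    (hY : Tendsto (fun h : ℝ => h⁻¹ • (A h - B)) F (𝓝 M))
    (hM : 0 < (M * (1 - supportProj B)).trace.re) :
    Tendsto (fun h : ℝ => entropyRemainder (A h) B / h) F atBot := by
  obtain ⟨C, hC⟩ : ∃ C, C = ∑ j, (hB.1.eigenvalues j)⁻¹ := ⟨_, rfl⟩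
  have hid : Tendsto (fun h : ℝ => h) F (𝓝 0) := hF.trans nhdsWithin_le_nhds
  have hw := tendsto_re_trace_slope_mul hY (1 - supportProj B)
  simp only [re_trace_mul_one_sub_supportProj_sub hB.1] at hw
  have hlog : Tendsto (fun h : ℝ => Real.log h - 1) F atBot :=
    tendsto_atBot_add_const_right _ _ (Real.tendsto_log_nhdsGT_zero.mono_left hF)
  have h2 : Tendsto (fun h : ℝ => ((A h - B) * (A h - B)).trace.re / h ^ 2 * (1 + h * C)) F
      (𝓝 ((M * M).trace.re * (1 + 0 * C))) :=
    (tendsto_trace_sq_div hY).mul ((hid.mul_const C).const_add 1)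
  refine tendsto_atBot_mono' F ?_ ((hw.pos_mul_atBot hM hlog).atBot_add h2)
  filter_upwards [hA, hF self_mem_nhdsWithin] with h hAh hh
  have hh' : 0 < h := hh
  -- With `δ = h` the quadratic term is `O(h)`, while leakage of order `h` times `log h` dominates.
  have h1 := entropyRemainder_le hAh hB hh'
  rw [← hC] at h1
  rw [div_le_iff₀ hh']
  refine h1.trans (le_of_eq ?_)
  field_simp

end Curve

/-! ### Extended-real values and admissible increments -/

omit [DecidableEq n] in
theorem im_trace_mul_eq_zero {X Y : Matrix n n ℂ} (hX : X.IsHermitian) (hY : Y.IsHermitian) :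
    (X * Y).trace.im = 0 := by
  have h : star (X * Y).trace = (X * Y).trace := by
    rw [← trace_conjTranspose, conjTranspose_mul, hX.eq, hY.eq, trace_mul_comm]
  exact Complex.conj_eq_iff_im.mp h

theorem traceLog_eq_coe {A B : Matrix n n ℂ} (h : (A * (1 - supportProj B)).trace.re = 0) :
    traceLog A B = ((A * cfc Real.log B).trace.re : ℝ) := by
  rw [traceLog, h, EReal.coe_zero, zero_mul, add_zero]

theorem traceLog_eq_bot {A B : Matrix n n ℂ} (h : 0 < (A * (1 - supportProj B)).trace.re) :
    traceLog A B = ⊥ := by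
  rw [traceLog, EReal.coe_mul_bot_of_pos h, EReal.add_bot]

theorem relEntropy_eq_coe {A B : Matrix n n ℂ} (hA : A.IsHermitian)
    (h : (A * (1 - supportProj B)).trace.re = 0) : relEntropy A B =
      (((A * cfc Real.log A).trace.re - (A * cfc Real.log B).trace.re : ℝ) : EReal) := by
  rw [relEntropy, traceLogSub, traceLog_eq_coe h,
    traceLog_eq_coe (trace_mul_one_sub_supportProj_self hA), EReal.coe_sub]

theorem trace_mul_one_sub_supportProj_of_relEntropy_ne_top {A B : Matrix n n ℂ}
    (hA : A.PosSemidef) (hB : B.IsHermitian) (h : relEntropy A B ≠ ⊤) :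
    (A * (1 - supportProj B)).trace.re = 0 := by
  refine (trace_mul_one_sub_supportProj_nonneg hA hB).eq_or_lt.resolve_right (fun h' => h ?_) |>.symm
  rw [relEntropy, traceLogSub, traceLog_eq_bot h',
    traceLog_eq_coe (trace_mul_one_sub_supportProj_self hA.1), EReal.coe_sub_bot]

theorem isHermitian_supportProj (B : Matrix n n ℂ) : (supportProj B).IsHermitian :=
  cfc_predicate _ B

theorem increments_le (t : ℝ) : increments t ≤ 𝓝[≠] 0 :=
  nhdsWithin_mono 0 fun _ hh => hh.1

theorem nhdsGT_le_increments {t : ℝ} (ht : 0 ≤ t) : 𝓝[>] 0 ≤ increments t :=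
  nhdsWithin_mono 0 fun _ hh => ⟨ne_of_gt hh, add_nonneg ht (le_of_lt hh)⟩

theorem increments_zero_le : increments 0 ≤ 𝓝[>] 0 :=
  nhdsWithin_mono 0 fun h hh => lt_of_le_of_ne (by simpa using hh.2) hh.1.symm

theorem nhdsLT_le_increments {t : ℝ} (ht : 0 < t) : 𝓝[<] 0 ≤ increments t := by
  refine le_inf nhdsWithin_le_nhds (le_principal_iff.mpr ?_)
  filter_upwards [self_mem_nhdsWithin, nhdsWithin_le_nhds (Ioi_mem_nhds (neg_lt_zero.mpr ht))]
    with h hh hh'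
  exact ⟨ne_of_lt hh, by linarith [Set.mem_Ioi.mp hh']⟩

end QuantumSemigroup

end

/-! ### The entropy production rate -/

open Filter Topology Matrix QuantumSemigroup in
theorem mainTheorem9 {n : Type*} [Fintype n] [DecidableEq n]
    (T : ℝ → (Matrix n n ℂ →ₗ[ℂ] Matrix n n ℂ)) (hT : QuantumSemigroup.IsDynamicalSemigroup T)
    (L : Matrix n n ℂ →ₗ[ℂ] Matrix n n ℂ) (hL : QuantumSemigroup.IsGenerator T L)
    (τ : Matrix n n ℂ) (hτ : QuantumSemigroup.IsState τ) (hfix : L τ = 0)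
    (ρ₀ : Matrix n n ℂ) (hρ₀ : QuantumSemigroup.IsState ρ₀)
    (hfin : QuantumSemigroup.relEntropy ρ₀ τ ≠ ⊤)
    (ρ : ℝ → Matrix n n ℂ) (hρ : ∀ t, 0 ≤ t → ρ t = T t ρ₀)
    (t : ℝ) (ht : 0 ≤ t) :
    ∃ σ : EReal, QuantumSemigroup.HasEntropyProductionRate ρ τ t σ ∧
      σ = QuantumSemigroup.traceLogSub (L (ρ t)) τ (ρ t)
          + (((L (ρ t) * QuantumSemigroup.supportProj (ρ t)).trace.re : ℝ) : EReal) ∧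
      0 ≤ σ ∧
      (σ ≠ ⊤ → (L (ρ t) * QuantumSemigroup.supportProj (ρ t)).trace = 0) := by
  have hTτ : ∀ s, 0 ≤ s → T s τ = τ := fun s hs => hT.apply_eq_of_generator_eq_zero hL hfix hs
  have hpos : ∀ s, 0 ≤ s → (ρ s).PosSemidef := fun s hs => by
    rw [hρ s hs]
    exact (hT.cptp s hs).1.posSemidef hρ₀.1
  have htr : ∀ s, 0 ≤ s → (ρ s).trace = 1 := fun s hs => by
    rw [hρ s hs, (hT.cptp s hs).2, hρ₀.2]
  have hsupp : ∀ s, 0 ≤ s → (ρ s * (1 - supportProj τ)).trace.re = 0 := fun s hs => by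
    have := (hT.cptp s hs).trace_mul_one_sub_supportProj_eq_zero hρ₀.1 hτ.1
      (trace_mul_one_sub_supportProj_of_relEntropy_ne_top hρ₀.1 hτ.1.1 hfin)
    rwa [hTτ s hs, ← hρ s hs] at this
  have hD : ∀ s, 0 ≤ s → relEntropy (ρ s) τ = (((ρ s * cfc Real.log (ρ s)).trace.re
      - (ρ s * cfc Real.log τ).trace.re : ℝ) : EReal) := fun s hs =>
    relEntropy_eq_coe (hpos s hs).1 (hsupp s hs)
  set M := L (ρ t) with hM
  set B := ρ t with hB
  have hBpos : B.PosSemidef := hpos t ht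
  have hF := increments_le t
  have hadm : ∀ᶠ h in increments t, h ≠ 0 ∧ 0 ≤ t + h := self_mem_nhdsWithin
  obtain ⟨Y, hY⟩ : ∃ Y, Tendsto (fun h : ℝ => (h ^ 2)⁻¹ • (ρ (t + h) - B - h • M))
      (increments t) (𝓝 Y) := by
    obtain ⟨Y, hY⟩ := hT.exists_tendsto_taylor hL ρ₀ ht
    refine ⟨Y, hY.congr' ?_⟩
    filter_upwards [hadm] with h hh
    rw [hM, hB, hρ t ht, hρ _ hh.2]
  have hd := tendsto_slope_of_taylor hF hY
  have hApos : ∀ᶠ h in increments t, (ρ (t + h)).PosSemidef := by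
    filter_upwards [hadm] with h hh using hpos _ hh.2
  have : (increments t).NeBot := NeBot.mono inferInstance (nhdsGT_le_increments ht)
  have hMtr : M.trace = 0 := by
    have h1 := tendsto_trace_slope_mul hd 1
    rw [mul_one] at h1
    refine tendsto_nhds_unique h1 (tendsto_const_nhds.congr' ?_)
    filter_upwards [hadm] with h hh
    rw [mul_one, trace_sub, htr _ hh.2, hB, htr t ht, sub_self, mul_zero]
  have hMτ : (M * (1 - supportProj τ)).trace.re = 0 := by
    refine tendsto_nhds_unique (tendsto_re_trace_slope_mul hd _) (tendsto_const_nhds.congr' ?_)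
    filter_upwards [hadm] with h hh
    rw [sub_mul, trace_sub, Complex.sub_re, hsupp _ hh.2, hB, hsupp t ht, sub_self, zero_div]
  -- The final claim is about a complex trace; its imaginary part vanishes because increments of
  -- states are Hermitian.
  have hMim : (M * supportProj B).trace.im = 0 := by
    have h1 := (Complex.continuous_im.tendsto _).comp (tendsto_trace_slope_mul hd (supportProj B))
    refine tendsto_nhds_unique h1 (tendsto_const_nhds.congr' ?_)
    filter_upwards [hadm] with h hh
    rw [Function.comp_apply, ← Complex.ofReal_inv, Complex.im_ofReal_mul,
      im_trace_mul_eq_zero ((hpos _ hh.2).1.sub hBpos.1) (isHermitian_supportProj B), mul_zero]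
  have hMsplit : (M * supportProj B).trace.re = -(M * (1 - supportProj B)).trace.re := by
    rw [mul_sub, mul_one, trace_sub, hMtr]
    simp
  have hquot : ∀ᶠ h in increments t,
      -((relEntropy (ρ (t + h)) τ - relEntropy (ρ t) τ) / (h : EReal)) =
        ((((ρ (t + h) - B) * cfc Real.log τ).trace.re / h
          - ((ρ (t + h) - B) * cfc Real.log B).trace.re / h
          - ((ρ (t + h) - B) * supportProj B).trace.re / h
          - entropyRemainder (ρ (t + h)) B / h : ℝ) : EReal) := by
    filter_upwards [hadm] with h hh
    rw [hD _ hh.2, hD t ht, ← EReal.coe_sub, ← EReal.coe_div, ← EReal.coe_neg, EReal.coe_eq_coe_iff,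
      entropyRemainder, sub_mul _ _ (cfc Real.log τ), trace_sub, Complex.sub_re]
    ring
  have hlin := ((tendsto_re_trace_slope_mul hd (cfc Real.log τ)).sub
    (tendsto_re_trace_slope_mul hd (cfc Real.log B))).sub
    (tendsto_re_trace_slope_mul hd (supportProj B))
  -- Quotients from the right suffice: `T h` maps `ρ t` to `ρ (t + h)` and fixes `τ`, so data
  -- processing applies.
  have hnonneg : ∀ σ, HasEntropyProductionRate ρ τ t σ → 0 ≤ σ := fun σ hσ => by
    refine ge_of_tendsto (Tendsto.mono_left hσ (nhdsGT_le_increments ht)) ?_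
    filter_upwards [self_mem_nhdsWithin] with h hh
    have hh' : 0 < h := hh
    have h1 := (hT.cptp h hh'.le).data_processing hBpos hτ.1 (hsupp t ht)
    have h2 : T h B = ρ (t + h) := by
      rw [hρ _ (by positivity), hB, hρ t ht, add_comm, hT.add h t hh'.le ht]
      rfl
    rw [hTτ h hh'.le, h2] at h1
    rw [hD _ (by positivity), hD t ht, ← EReal.coe_sub, ← EReal.coe_div, ← EReal.coe_neg]
    exact EReal.coe_nonneg.mpr (neg_nonneg.mpr
      (div_nonpos_of_nonpos_of_nonneg (sub_nonpos.mpr h1) hh'.le))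
  have hleak := tendsto_re_trace_slope_mul hd (1 - supportProj B)
  simp only [re_trace_mul_one_sub_supportProj_sub hBpos.1] at hleak
  have hc : 0 ≤ (M * (1 - supportProj B)).trace.re := by
    refine ge_of_tendsto (hleak.mono_left (nhdsGT_le_increments ht)) ?_
    filter_upwards [self_mem_nhdsWithin] with h hh
    have hh' : 0 < h := hh
    exact div_nonneg (trace_mul_one_sub_supportProj_nonneg (hpos _ (by positivity)) hBpos.1) hh'.le
  rcases hc.eq_or_lt with hc | hc
  · have hrate : HasEntropyProductionRate ρ τ t (((M * cfc Real.log τ).trace.re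
        - (M * cfc Real.log B).trace.re - (M * supportProj B).trace.re : ℝ) : EReal) := by
      have h1 := hlin.sub (tendsto_entropyRemainder_div_zero hF hBpos hApos hY hc.symm)
      rw [sub_zero] at h1
      refine (EReal.tendsto_coe.mpr h1).congr' ?_
      filter_upwards [hquot] with h hh using hh.symm
    refine ⟨_, hrate, ?_, hnonneg _ hrate, fun _ => ?_⟩
    · rw [traceLogSub, traceLog_eq_coe hMτ, traceLog_eq_coe hc.symm, ← EReal.coe_sub,
        ← EReal.coe_add, hMsplit, ← hc]
      simp
    · exact Complex.ext (by rw [hMsplit, ← hc]; simp) hMim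
  -- For `t > 0` the leakage quotients from the left are nonpositive, contradicting a positive
  -- limit.
  · have ht0 : t = 0 := by
      by_contra hne
      have htpos : 0 < t := lt_of_le_of_ne ht (Ne.symm hne)
      refine absurd hc (not_lt.mpr ?_)
      refine le_of_tendsto (hleak.mono_left (nhdsLT_le_increments htpos)) ?_
      filter_upwards [self_mem_nhdsWithin, nhdsLT_le_increments htpos self_mem_nhdsWithin]
        with h hh hh'
      exact div_nonpos_of_nonneg_of_nonpos
        (trace_mul_one_sub_supportProj_nonneg (hpos _ hh'.2) hBpos.1) (le_of_lt hh)
    have hF' : increments t ≤ 𝓝[>] 0 := by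
      rw [ht0]
      exact increments_zero_le
    have hrate : HasEntropyProductionRate ρ τ t ⊤ := by
      have h1 := hlin.add_atTop (tendsto_neg_atBot_atTop.comp
        (tendsto_entropyRemainder_div_atBot hF' hBpos hApos hd hc))
      refine (EReal.tendsto_coe_nhds_top_iff.mpr h1).congr' ?_
      filter_upwards [hquot] with h hh
      rw [hh, Function.comp_apply, ← sub_eq_add_neg]
    refine ⟨⊤, hrate, ?_, le_top, fun h => absurd rfl h⟩
    rw [traceLogSub, traceLog_eq_coe hMτ, traceLog_eq_bot hc, EReal.coe_sub_bot, EReal.top_add_coe]
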